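/- Let $G=(V,E)$ be a connected simple graph with countably many vertices, and suppose there is a constant $D$ with $\deg(v)\le D$ for every vertex $v$. View every edge as a pair of opposite arcs. A \emph{port orientation} at a vertex $v$ is a bijective labelling of the arcs leaving $v$ by $1,\dots,\deg(v)$. Choose, independently for all vertices $v$, a port orientation at $v$ uniformly at random from the $\deg(v)!$ possible ones. Fix an initial vertex $v_0$ and an initial port $i_0\in\{1,\dots,\deg(v_0)\}$. The \emph{random basic walk} started at $(v_0,i_0)$ is the sequence of states $(v_n,i_n)_{n\ge 0}$ determined by the labels as follows: $v_{n+1}$ is the endpoint of the arc leaving $v_n$ with label $i_n$, and $i_{n+1}=(i_n \bmod \deg(v_{n+1}))+1$. The walk \emph{cycles} if its sequence of states is eventually periodic, i.e. there are $N\ge 0$ and $T\ge 1$ such that $(v_{n+T},i_{n+T})=(v_n,i_n)$ for all $n\ge N$. Theorem. For every initial vertex $v_0$ and every initial port $i_0$, the random basic walk started at $(v_0,i_0)$ cycles with probability $1$. -/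

import Mathlib

open MeasureTheory

namespace BasicWalk

variable {V : Type*} (G : SimpleGraph V) [G.LocallyFinite]

/-- A port orientation at `v`: a bijective labelling of the arcs going out of `v` (one arc for each
neighbour) by the `deg v` port numbers. The port numbers `1, …, deg v` are represented by the
elements `0, …, deg v - 1` of `Fin (G.degree v)`. -/
abbrev PortOrientation (v : V) : Type _ := G.neighborSet v ≃ Fin (G.degree v)

/-- A labelling of the graph: a port orientation at every vertex. The labels of the two arcs
`v → w` and `w → v` are unrelated. -/
abbrev Labeling : Type _ := (v : V) → PortOrientation G v

/-- A state `(v, i)` of the robot: its position `v` and the port `i` that it uses next. -/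
abbrev State : Type _ := (v : V) × Fin (G.degree v)

variable {G}

/-- The transition function: from `(v, i)` the robot follows the arc `v → w` with label `i`, and
at `w` its next port is the cyclic successor of `i` with respect to `deg w`. In terms of port
numbers starting from `1` this is `(i mod deg w) + 1`; with port numbers starting from `0` it reads
`(i + 1) mod deg w`. -/
def step (L : Labeling G) (s : State G) : State G :=
  let w : G.neighborSet s.1 := (L s.1).symm s.2
  ⟨w.1, ⟨(s.2.val + 1) % G.degree w.1,
    Nat.mod_lt _ ((G.degree_pos_iff_exists_adj w.1).2 ⟨s.1, G.adj_symm w.2⟩)⟩⟩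

/-- The state of the robot after `n` steps, when it starts in the state `s`. -/
def walk (L : Labeling G) (s : State G) (n : ℕ) : State G := (step L)^[n] s

/-- The basic walk with labelling `L` started in `s` cycles: from some time on it repeats the same
finite sequence of states forever. -/
def Cycles (L : Labeling G) (s : State G) : Prop :=
  ∃ N T : ℕ, 0 < T ∧ ∀ n, N ≤ n → walk L s (n + T) = walk L s n

variable (G)

/-- The finite set of port orientations at a vertex is a discrete measurable space; the space of
labellings then carries the product `σ`-algebra. -/
instance (v : V) : MeasurableSpace (PortOrientation G v) := ⊤

noncomputable instance (v : V) : Fintype (PortOrientation G v) := Fintype.ofFinite _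

instance (v : V) : Nonempty (PortOrientation G v) :=
  ⟨Fintype.equivFinOfCardEq (G.card_neighborSet_eq_degree v)⟩

/-- The law of a port orientation at `v` that is chosen uniformly at random. -/
noncomputable def portLaw (v : V) : Measure (PortOrientation G v) :=
  (PMF.uniformOfFintype (PortOrientation G v)).toMeasure

instance (v : V) : IsProbabilityMeasure (portLaw G v) := by
  unfold portLaw; infer_instance

/-- The law of the random labelling: the port orientations at the vertices are independent, and
each of them is uniformly distributed. -/
noncomputable def labelingLaw : Measure (Labeling G) := Measure.infinitePi (portLaw G)

end BasicWalk

/-! A walk that does not cycle never repeats a state, so it visits infinitely many vertices. Reveal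
labels only when the walk reads them. While no state has been repeated, the next arc is uniform
among the unused arcs out of the current vertex, so each of these is taken with conditional
probability at least `1/D`. The form needed is `exists_extends_succ`, proved by exchanging labels.

The trap (`trapped_of_degree_le`): let the walk enter a new vertex `x` from `u`, and let `z` be an
unvisited neighbour of `x` with `deg z ≤ deg x` and a further neighbour `z' ≠ x`. After an excursion
from `x` to every neighbour except `u` and `z`, only one port at `x` is unused. If neither route `x
z x` nor `x z z' z x` repeated a state, both would return to `x` with that port. Their last ports at
`z` would then agree modulo `deg x`, hence be equal, and the second route would repeat a state at
`z` after all. If `deg z > deg x`, the walk moves on to `z` instead; this happens at most `D` times,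
so a fresh path of length `D + 2` suffices (`trapped_of_isPath`).

A walk without repetition meets such paths arbitrarily late (`exists_promising`). Hence the
probability `p` of no repetition ever and the probability `q` of none up to time `N` satisfy `c * p
+ p ≤ c * q` with `c = D ^ (3 * D)`. As `N` grows, `q` tends to `p`, which forces `p = 0`. -/

namespace BasicWalk

variable {V : Type*} {G : SimpleGraph V} [G.LocallyFinite]

/-! ### Histories of the walk -/

/-- The vertex visited after `n` steps. -/
def pos (L : Labeling G) (s : State G) (n : ℕ) : V := (walk L s n).1

/-- The port used after `n` steps, as a natural number. -/
def port (L : Labeling G) (s : State G) (n : ℕ) : ℕ := (walk L s n).2.val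

lemma state_ext {s t : State G} (h₁ : s.1 = t.1) (h₂ : s.2.val = t.2.val) : s = t := by
  obtain ⟨v, i⟩ := s
  obtain ⟨w, j⟩ := t
  obtain rfl : v = w := h₁
  obtain rfl : i = j := Fin.ext h₂
  rfl

lemma walk_succ (L : Labeling G) (s : State G) (n : ℕ) :
    walk L s (n + 1) = step L (walk L s n) :=
  Function.iterate_succ_apply' _ _ _

lemma step_snd (L : Labeling G) (t : State G) :
    (step L t).2.val = (t.2.val + 1) % G.degree (step L t).1 := rfl

lemma step_fst (L : Labeling G) (t : State G) :
    (step L t).1 = ((L t.1).symm t.2 : V) := rfl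

lemma adj_step (L : Labeling G) (t : State G) : G.Adj t.1 (step L t).1 :=
  ((L t.1).symm t.2).2

/-- The labelling enters the next port only through the next vertex, so histories can be compared
vertex by vertex. -/
lemma step_eq_of_fst_eq {L L' : Labeling G} {t : State G} (h : (step L t).1 = (step L' t).1) :
    step L t = step L' t :=
  state_ext h (by rw [step_snd, step_snd, h])

lemma adj_pos (L : Labeling G) (s : State G) (n : ℕ) : G.Adj (pos L s n) (pos L s (n + 1)) := by
  unfold pos
  rw [walk_succ]
  exact adj_step L _

lemma port_succ (L : Labeling G) (s : State G) (n : ℕ) :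
    port L s (n + 1) = (port L s n + 1) % G.degree (pos L s (n + 1)) := by
  unfold port pos
  rw [walk_succ]
  exact step_snd L _

lemma port_lt (L : Labeling G) (s : State G) (n : ℕ) :
    port L s n < G.degree (pos L s n) := (walk L s n).2.isLt

/-- The states at the times `0, …, n` are distinct. -/
def NoRepeat (L : Labeling G) (s : State G) (n : ℕ) : Prop :=
  ∀ i j, i < j → j ≤ n → walk L s i ≠ walk L s j

/-- The labelings for which the walk agrees with that of `L` up to time `n`. -/
def cylinder (L : Labeling G) (s : State G) (n : ℕ) : Set (Labeling G) :=
  {L' | ∀ k ≤ n, walk L' s k = walk L s k}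

/-- The arc from `v` to `w` is not used in the first `n` steps. -/
def UnusedArc (L : Labeling G) (s : State G) (n : ℕ) (v w : V) : Prop :=
  ∀ k < n, pos L s k = v → pos L s (k + 1) ≠ w

lemma NoRepeat.mono {L : Labeling G} {s : State G} {m n : ℕ} (h : NoRepeat L s n) (hmn : m ≤ n) :
    NoRepeat L s m := fun i j hij hj => h i j hij (hj.trans hmn)

lemma NoRepeat.of_mem_cylinder {L L' : Labeling G} {s : State G} {n : ℕ} (h : NoRepeat L s n)
    (hL : L' ∈ cylinder L s n) : NoRepeat L' s n := fun i j hij hj => by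
  rw [hL i (hij.le.trans hj), hL j hj]
  exact h i j hij hj

lemma self_mem_cylinder (L : Labeling G) (s : State G) (n : ℕ) : L ∈ cylinder L s n :=
  fun _ _ => rfl

lemma pos_eq_of_mem_cylinder {L L' : Labeling G} {s : State G} {n k : ℕ}
    (hL : L' ∈ cylinder L s n) (hk : k ≤ n) : pos L' s k = pos L s k := by
  unfold pos
  rw [hL k hk]

lemma port_eq_of_mem_cylinder {L L' : Labeling G} {s : State G} {n k : ℕ}
    (hL : L' ∈ cylinder L s n) (hk : k ≤ n) : port L' s k = port L s k := by
  unfold port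
  rw [hL k hk]

lemma NoRepeat.port_ne {L : Labeling G} {s : State G} {n i j : ℕ} (h : NoRepeat L s n)
    (hij : i < j) (hj : j ≤ n) (hp : pos L s i = pos L s j) : port L s i ≠ port L s j :=
  fun hq => h i j hij hj (state_ext hp hq)

/-! ### Label exchanges preserve the law -/

open Classical in
/-- The labeling in which the labels of the arcs from `v` to `a` and to `b` are exchanged. -/
noncomputable def swapArcs (v : V) (a b : G.neighborSet v) (u : V)
    (e : PortOrientation G u) : PortOrientation G u :=
  if h : u = v then
    (Equiv.swap (h ▸ a : G.neighborSet u) (h ▸ b : G.neighborSet u)).trans e else e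

lemma swapArcs_of_ne {v u : V} (a b : G.neighborSet v) (h : u ≠ v) (e : PortOrientation G u) :
    swapArcs v a b u e = e := by
  simp [swapArcs, h]

open Classical in
lemma swapArcs_self {v : V} (a b : G.neighborSet v) (e : PortOrientation G v) :
    swapArcs v a b v e = (Equiv.swap a b).trans e := by
  simp [swapArcs]

lemma swapArcs_injective (v : V) (a b : G.neighborSet v) (u : V) :
    Function.Injective (swapArcs v a b u) := by
  classical
  by_cases h : u = v
  · subst h
    intro e f hef
    rw [swapArcs_self, swapArcs_self] at hef
    ext x
    have := congrArg (fun g => g ((Equiv.swap a b).symm x)) hef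
    simpa using congrArg Fin.val this
  · intro e f hef
    rwa [swapArcs_of_ne a b h, swapArcs_of_ne a b h] at hef

/-- An injective self-map of a finite type is a permutation, and permutations preserve the uniform
law. -/
lemma portLaw_map_of_injective (v : V) {f : PortOrientation G v → PortOrientation G v}
    (hf : Function.Injective f) : (portLaw G v).map f = portLaw G v := by
  classical
  have hbij : Function.Bijective f := Finite.injective_iff_bijective.1 hf
  ext t ht
  rw [Measure.map_apply measurable_from_top ht]
  unfold portLaw
  rw [PMF.toMeasure_uniformOfFintype_apply _ (measurable_from_top ht),
    PMF.toMeasure_uniformOfFintype_apply _ ht]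
  congr 2
  exact Fintype.card_congr
    ((Equiv.ofBijective f hbij).subtypeEquiv fun x => Iff.rfl)

lemma labelingLaw_preimage {f : (v : V) → PortOrientation G v → PortOrientation G v}
    (hf : ∀ v, Function.Injective (f v)) {A : Set (Labeling G)} (hA : MeasurableSet A) :
    labelingLaw G ((fun L v => f v (L v)) ⁻¹' A) = labelingLaw G A := by
  have hm : ∀ v, Measurable (f v) := fun v => measurable_from_top
  have h : (labelingLaw G).map (fun L v => f v (L v)) = labelingLaw G := by
    unfold labelingLaw
    rw [Measure.infinitePi_map_pi _ hm]
    simp_rw [fun v => portLaw_map_of_injective v (hf v)]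
  conv_rhs => rw [← h]
  rw [Measure.map_apply (by fun_prop) hA]

/-! ### Measurability of events of the walk -/

section Measurability

lemma measurableSet_step (t t' : State G) : MeasurableSet {L : Labeling G | step L t = t'} := by
  have : {L : Labeling G | step L t = t'} =
      (fun L : Labeling G => L t.1) ⁻¹' {e : PortOrientation G t.1 |
        (e.symm t.2 : V) = t'.1 ∧ t'.2.val = (t.2.val + 1) % G.degree t'.1} := by
    ext L
    constructor
    · rintro rfl
      exact ⟨rfl, rfl⟩
    · rintro ⟨h₁, h₂⟩
      have h₁' : (step L t).1 = t'.1 := h₁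
      exact state_ext h₁' (by rw [step_snd, h₁', h₂])
  rw [this]
  exact measurable_pi_apply t.1 trivial

variable [Countable V]

lemma measurableSet_walk (s : State G) (n : ℕ) (t : State G) :
    MeasurableSet {L : Labeling G | walk L s n = t} := by
  induction n generalizing t with
  | zero => exact MeasurableSet.const (s = t)
  | succ n ih =>
    have : {L : Labeling G | walk L s (n + 1) = t} =
        ⋃ t', {L : Labeling G | walk L s n = t'} ∩ {L : Labeling G | step L t' = t} := by
      ext L
      simp [walk_succ]
    rw [this]
    exact MeasurableSet.iUnion fun t' => (ih t').inter (measurableSet_step t' t)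

lemma measurableSet_cylinder (L : Labeling G) (s : State G) (n : ℕ) :
    MeasurableSet (cylinder L s n) := by
  have : cylinder L s n = ⋂ k, ⋂ _ : k ≤ n, {L' : Labeling G | walk L' s k = walk L s k} := by
    ext L'
    simp [cylinder]
  rw [this]
  exact MeasurableSet.iInter fun k => MeasurableSet.iInter fun _ => measurableSet_walk s k _

lemma measurableSet_walk_eq_walk (s : State G) (i j : ℕ) :
    MeasurableSet {L : Labeling G | walk L s i = walk L s j} := by
  have : {L : Labeling G | walk L s i = walk L s j} =
      ⋃ t, {L : Labeling G | walk L s i = t} ∩ {L : Labeling G | walk L s j = t} := by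
    ext L
    simp [eq_comm]
  rw [this]
  exact MeasurableSet.iUnion fun t => (measurableSet_walk s i t).inter (measurableSet_walk s j t)

lemma measurableSet_noRepeat (s : State G) (n : ℕ) :
    MeasurableSet {L : Labeling G | NoRepeat L s n} := by
  have : {L : Labeling G | NoRepeat L s n} =
      ⋂ i, ⋂ j, ⋂ _ : i < j, ⋂ _ : j ≤ n, {L : Labeling G | walk L s i = walk L s j}ᶜ := by
    ext L
    simp [NoRepeat]
  rw [this]
  exact MeasurableSet.iInter fun i => MeasurableSet.iInter fun j => MeasurableSet.iInter fun _ =>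
    MeasurableSet.iInter fun _ => (measurableSet_walk_eq_walk s i j).compl

end Measurability

/-! ### Forcing one step -/

/-- The history up to time `n` reads only the labels of arcs already used, and the exchange leaves
those alone. -/
lemma swapArcs_mem_cylinder {L L' : Labeling G} {s : State G} {n : ℕ} {v : V}
    {a b : G.neighborSet v} (hL : L' ∈ cylinder L s n) (ha : UnusedArc L s n v a)
    (hb : UnusedArc L s n v b) : (fun u => swapArcs v a b u (L' u)) ∈ cylinder L s n := by
  classical
  intro k hk
  induction k with
  | zero => rfl
  | succ k ih =>
    have hk' : k < n := hk
    rw [← hL (k + 1) hk, walk_succ, walk_succ, ih hk'.le, ← hL k hk'.le]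
    apply step_eq_of_fst_eq
    rw [step_fst, step_fst]
    by_cases h : (walk L' s k).1 = v
    · have key : ∀ c : G.neighborSet v, UnusedArc L s n v c →
          ((L' (walk L' s k).1).symm (walk L' s k).2 : V) ≠ c := by
        intro c hc
        have := hc k hk' (by rw [← pos_eq_of_mem_cylinder hL hk'.le]; exact h)
        rw [← pos_eq_of_mem_cylinder hL hk] at this
        unfold pos at this
        rwa [walk_succ] at this
      have h₁ := key a ha
      have h₂ := key b hb
      clear key
      generalize walk L' s k = t at *
      obtain ⟨u, i⟩ := t
      obtain rfl : u = v := h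
      simp only [swapArcs_self, Equiv.symm_trans_apply, Equiv.symm_swap]
      rw [Equiv.swap_apply_of_ne_of_ne]
      · exact fun h => h₁ (congrArg Subtype.val h)
      · exact fun h => h₂ (congrArg Subtype.val h)
    · rw [swapArcs_of_ne a b h]

lemma step_swapArcs {L : Labeling G} {t : State G} {a b : G.neighborSet t.1}
    (h : (step L t).1 = a) : (step (fun u => swapArcs t.1 a b u (L u)) t).1 = b := by
  classical
  rw [step_fst] at h ⊢
  simp only [swapArcs_self, Equiv.symm_trans_apply, Equiv.symm_swap]
  rw [Subtype.ext h, Equiv.swap_apply_left]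

/-- The labeling `L'` continues the history of `L` from time `n` to time `n'`, and the conditional
probability of this continuation is at least `D⁻¹` to the number of steps. -/
structure Extends (D : ℕ) (s : State G) (L : Labeling G) (n : ℕ) (L' : Labeling G) (n' : ℕ) :
    Prop where
  le : n ≤ n'
  mem : L' ∈ cylinder L s n
  measure_le : labelingLaw G (cylinder L s n) ≤
    (D : ENNReal) ^ (n' - n) * labelingLaw G (cylinder L' s n')

lemma Extends.refl (D : ℕ) (s : State G) (L : Labeling G) (n : ℕ) : Extends D s L n L n :=
  ⟨le_rfl, self_mem_cylinder L s n, by simp⟩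

lemma Extends.trans {D : ℕ} {s : State G} {L₁ L₂ L₃ : Labeling G} {n₁ n₂ n₃ : ℕ}
    (h : Extends D s L₁ n₁ L₂ n₂) (h' : Extends D s L₂ n₂ L₃ n₃) : Extends D s L₁ n₁ L₃ n₃ := by
  refine ⟨h.le.trans h'.le, fun k hk => ?_, ?_⟩
  · rw [h'.mem k (hk.trans h.le), h.mem k hk]
  · calc labelingLaw G (cylinder L₁ s n₁)
        ≤ (D : ENNReal) ^ (n₂ - n₁) * labelingLaw G (cylinder L₂ s n₂) := h.measure_le
      _ ≤ (D : ENNReal) ^ (n₂ - n₁) *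
          ((D : ENNReal) ^ (n₃ - n₂) * labelingLaw G (cylinder L₃ s n₃)) := by
        gcongr; exact h'.measure_le
      _ = (D : ENNReal) ^ (n₃ - n₁) * labelingLaw G (cylinder L₃ s n₃) := by
        rw [← mul_assoc, ← pow_add]
        congr 2
        have := h.le
        have := h'.le
        omega

/-- The cylinder is split by the next vertex. A used arc cannot come next, and exchanging any unused
arc with the one to `w` carries its piece into the piece of `w` without changing measure. So the
piece of `w` is largest among at most `D`. -/
lemma exists_extends_succ [Countable V] {D : ℕ} (hD : ∀ v, G.degree v ≤ D) {s : State G} {L : Labeling G}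
    {n : ℕ} (hL : NoRepeat L s n) {w : V} (hw : G.Adj (pos L s n) w)
    (hu : UnusedArc L s n (pos L s n) w) :
    ∃ L', Extends D s L n L' (n + 1) ∧ pos L' s (n + 1) = w := by
  classical
  set t := walk L s n with ht
  let T : V → Set (Labeling G) := fun x => cylinder L s n ∩ {L' | (step L' t).1 = x}
  have hstep : ∀ L' ∈ cylinder L s n, walk L' s (n + 1) = step L' t := fun L' h => by
    rw [walk_succ, h n le_rfl]
  have hunused : ∀ L' ∈ cylinder L s n, UnusedArc L s n t.1 (step L' t).1 := by
    intro L' hL' k hk hkv hkw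
    -- An arc has a single label, so using it again means leaving the same vertex by the same port:
    -- a repeated state.
    refine hL k n hk le_rfl (state_ext hkv ?_)
    rw [← pos_eq_of_mem_cylinder hL' hk] at hkw
    unfold pos at hkw
    rw [walk_succ, hL' k hk.le] at hkw
    unfold pos at hkv
    rw [← ht]
    generalize walk L s k = r at *
    obtain ⟨v, i⟩ := r
    generalize t = r' at *
    obtain ⟨v', j⟩ := r'
    obtain rfl : v = v' := hkv
    rw [step_fst, step_fst] at hkw
    exact congrArg Fin.val ((L' v).symm.injective (Subtype.ext hkw))
  have hswap : ∀ x : G.neighborSet t.1, UnusedArc L s n t.1 x → ∀ L' ∈ T x,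
      (fun u => swapArcs t.1 x ⟨w, hw⟩ u (L' u)) ∈ T w := fun x hx L' hL' =>
    ⟨swapArcs_mem_cylinder hL'.1 hx hu, step_swapArcs (b := ⟨w, hw⟩) hL'.2⟩
  have hL₀ := hswap ⟨_, adj_step L t⟩ (hunused L (self_mem_cylinder L s n)) L
    ⟨self_mem_cylinder L s n, rfl⟩
  generalize (fun u => swapArcs t.1 ⟨_, adj_step L t⟩ ⟨w, hw⟩ u (L u)) = L₁ at hL₀
  have hsub : T w ⊆ cylinder L₁ s (n + 1) := by
    intro L' hL' k hk
    rcases Nat.lt_or_ge n k with h | h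
    · obtain rfl : k = n + 1 := by omega
      rw [hstep L' hL'.1, hstep L₁ hL₀.1]
      exact step_eq_of_fst_eq (hL'.2.trans hL₀.2.symm)
    · rw [hL'.1 k h, hL₀.1 k h]
  have hmeas : ∀ x, MeasurableSet (T x) := by
    intro x
    refine (measurableSet_cylinder L s n).inter ?_
    have : {L' : Labeling G | (step L' t).1 = x} = ⋃ i : Fin (G.degree x),
        {L' | step L' t = ⟨x, i⟩} := by
      ext L'
      simp only [Set.mem_ofPred_eq, Set.mem_iUnion]
      constructor
      · rintro rfl
        exact ⟨_, rfl⟩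
      · rintro ⟨i, hi⟩
        rw [hi]
    rw [this]
    exact MeasurableSet.iUnion fun i => measurableSet_step t _
  have hle : ∀ x : G.neighborSet t.1, labelingLaw G (cylinder L s n ∩ T x) ≤
      labelingLaw G (T w) := by
    intro x
    by_cases hx : UnusedArc L s n t.1 x
    · rw [← labelingLaw_preimage (swapArcs_injective t.1 x ⟨w, hw⟩) (hmeas w)]
      exact measure_mono fun L' hL' => hswap x hx L' hL'.2
    · have : cylinder L s n ∩ T x = ∅ := by
        refine Set.eq_empty_of_forall_notMem fun L' hL' => hx ?_
        have := hunused L' hL'.1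
        rwa [show (step L' t).1 = x from hL'.2.2] at this
      simp [this]
  refine ⟨L₁, ⟨n.le_succ, hL₀.1, ?_⟩, ?_⟩
  · have hcover : cylinder L s n ⊆ ⋃ x : G.neighborSet t.1, cylinder L s n ∩ T x := fun L' hL' =>
      Set.mem_iUnion.2 ⟨⟨_, adj_step L' t⟩, hL', hL', rfl⟩
    calc labelingLaw G (cylinder L s n)
        ≤ ∑ x : G.neighborSet t.1, labelingLaw G (cylinder L s n ∩ T x) :=
          (measure_mono hcover).trans (measure_iUnion_fintype_le _ _)
      _ ≤ ∑ x : G.neighborSet t.1, labelingLaw G (T w) := Finset.sum_le_sum fun x _ => hle x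
      _ = (G.degree t.1 : ENNReal) * labelingLaw G (T w) := by
          rw [Finset.sum_const, Finset.card_univ, G.card_neighborSet_eq_degree, nsmul_eq_mul]
      _ ≤ (D : ENNReal) ^ (n + 1 - n) * labelingLaw G (cylinder L₁ s (n + 1)) := by
          rw [Nat.add_sub_cancel_left, pow_one]
          gcongr
          · exact hD _
  · unfold pos
    rw [hstep L₁ hL₀.1]
    exact hL₀.2

end BasicWalk

/-! ### The trap -/

namespace BasicWalk

variable {V : Type*} {G : SimpleGraph V} [G.LocallyFinite]

/-- With conditional probability bounded below, the walk repeats a state in the next `m` steps. -/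
def Trapped (D : ℕ) (s : State G) (L : Labeling G) (n m : ℕ) : Prop :=
  ∃ L' n', Extends D s L n L' n' ∧ n' ≤ n + m ∧ ¬ NoRepeat L' s n'

lemma Trapped.of_extends {D : ℕ} {s : State G} {L L' : Labeling G} {n n' m m' : ℕ}
    (h : Extends D s L n L' n') (ht : Trapped D s L' n' m') (hm : n' + m' ≤ n + m) :
    Trapped D s L n m := by
  obtain ⟨L'', n'', hE, hn, hR⟩ := ht
  exact ⟨L'', n'', h.trans hE, hn.trans hm, hR⟩

lemma Extends.pos_eq {D : ℕ} {s : State G} {L L' : Labeling G} {n n' k : ℕ}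
    (h : Extends D s L n L' n') (hk : k ≤ n) : pos L' s k = pos L s k :=
  pos_eq_of_mem_cylinder h.mem hk

lemma Extends.port_eq {D : ℕ} {s : State G} {L L' : Labeling G} {n n' k : ℕ}
    (h : Extends D s L n L' n') (hk : k ≤ n) : port L' s k = port L s k :=
  port_eq_of_mem_cylinder h.mem hk

variable [Countable V]

open Classical in
/-- From a vertex `x` visited for the first time, the walk can make an excursion to each of the
neighbours in `Y`, unless it repeats a state. -/
lemma trapped_or_excursions {D : ℕ} (hD : ∀ v, G.degree v ≤ D) {s : State G} {L : Labeling G}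
    {n : ℕ} (hL : NoRepeat L s (n + 1)) {x : V} (hx : pos L s (n + 1) = x)
    (hfirst : ∀ k ≤ n, pos L s k ≠ x) (Y : Finset V)
    (hY : ∀ y ∈ Y, G.Adj x y ∧ y ≠ pos L s n) :
    Trapped D s L (n + 1) (2 * Y.card) ∨
    ∃ L', Extends D s L (n + 1) L' (n + 1 + 2 * Y.card) ∧ NoRepeat L' s (n + 1 + 2 * Y.card) ∧
      pos L' s (n + 1 + 2 * Y.card) = x ∧
      (∀ k, n < k → k < n + 1 + 2 * Y.card →
        (pos L' s k = x ∧ pos L' s (k + 1) ∈ Y) ∨ (pos L' s k ∈ Y ∧ pos L' s (k + 1) = x)) ∧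
      ((Finset.range (n + 1 + 2 * Y.card + 1)).filter fun k => pos L' s k = x).card
        = Y.card + 1 := by
  induction Y using Finset.induction_on with
  | empty =>
    refine Or.inr ⟨L, Extends.refl D s L _, hL, hx, fun k h₁ h₂ => ?_, ?_⟩
    · simp at h₂; omega
    · rw [show ((Finset.range (n + 1 + 2 * (∅ : Finset V).card + 1)).filter
        fun k => pos L s k = x) = {n + 1} from ?_]
      · simp
      · ext k
        simp only [Finset.card_empty, Finset.mem_filter, Finset.mem_range, Finset.mem_singleton]
        constructor
        · rintro ⟨h₁, h₂⟩
          by_contra h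
          exact hfirst k (by omega) h₂
        · rintro rfl
          exact ⟨by omega, hx⟩
  | insert y Y hy ih =>
    rw [Finset.card_insert_of_notMem hy]
    obtain ⟨hxy, hyu⟩ := hY y (Finset.mem_insert_self y Y)
    have hYx : ∀ z ∈ Y, z ≠ x := fun z hz => (hY z (Finset.mem_insert_of_mem hz)).1.ne'
    rcases ih fun z hz => hY z (Finset.mem_insert_of_mem hz) with h | ⟨L₁, hE, hR, hp, harc, hcard⟩
    · exact Or.inl (Trapped.of_extends (Extends.refl D s L _) h (by omega))
    set N := n + 1 + 2 * Y.card with hN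
    have hpos : ∀ k ≤ n + 1, pos L₁ s k = pos L s k := fun k hk => hE.pos_eq hk
    -- Earlier departures from `x` led into `Y`, which does not contain `y`.
    have hua : UnusedArc L₁ s N (pos L₁ s N) y := by
      intro k hk h₁ h₂
      rw [hp] at h₁
      rcases Nat.lt_or_ge n k with h | h
      · rcases harc k h hk with ⟨_, h'⟩ | ⟨h', _⟩
        · exact hy (h₂ ▸ h')
        · exact hYx _ h' h₁
      · rw [hpos k (by omega)] at h₁
        exact hfirst k h h₁
    obtain ⟨L₂, hE₂, hp₂⟩ := exists_extends_succ hD hR (hp.symm ▸ hxy) hua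
    have hpos₂ : ∀ k ≤ N, pos L₂ s k = pos L₁ s k := fun k hk => hE₂.pos_eq hk
    by_cases hR₂ : NoRepeat L₂ s (N + 1)
    swap
    · exact Or.inl ⟨L₂, N + 1, hE.trans hE₂, by omega, hR₂⟩
    -- So far `x` was entered only from `pos L s n` and from vertices of `Y`; this is why `y` must
    -- differ from `pos L s n`.
    have hub : UnusedArc L₂ s (N + 1) (pos L₂ s (N + 1)) x := by
      intro k hk h₁ h₂
      rw [hp₂] at h₁
      rcases Nat.lt_or_ge k N with hkN | hkN
      · rw [hpos₂ k hkN.le] at h₁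
        rw [hpos₂ (k + 1) hkN] at h₂
        rcases Nat.lt_or_ge n k with h | h
        · rcases harc k h hkN with ⟨h', _⟩ | ⟨h', _⟩
          · exact hxy.ne (h'.symm.trans h₁)
          · exact hy (h₁ ▸ h')
        · rw [hpos k (by omega)] at h₁
          rw [hpos (k + 1) (by omega)] at h₂
          rcases Nat.lt_or_ge k n with h' | h'
          · exact hfirst (k + 1) h' h₂
          · obtain rfl : k = n := by omega
            exact hyu h₁.symm
      · obtain rfl : k = N := by omega
        rw [hpos₂ N le_rfl, hp] at h₁
        exact hxy.ne h₁
    obtain ⟨L₃, hE₃, hp₃⟩ := exists_extends_succ hD hR₂ (hp₂.symm ▸ hxy.symm) hub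
    have hpos₃ : ∀ k ≤ N + 1, pos L₃ s k = pos L₂ s k := fun k hk => hE₃.pos_eq hk
    have hN' : n + 1 + 2 * (Y.card + 1) = N + 1 + 1 := by omega
    rw [hN']
    by_cases hR₃ : NoRepeat L₃ s (N + 1 + 1)
    swap
    · exact Or.inl ⟨L₃, N + 1 + 1, (hE.trans hE₂).trans hE₃, by omega, hR₃⟩
    refine Or.inr ⟨L₃, (hE.trans hE₂).trans hE₃, hR₃, hp₃, fun k h₁ h₂ => ?_, ?_⟩
    · rcases Nat.lt_or_ge k N with hkN | hkN
      · rw [hpos₃ k (by omega), hpos₃ (k + 1) (by omega), hpos₂ k hkN.le, hpos₂ (k + 1) hkN]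
        exact (harc k h₁ hkN).imp (And.imp_right (Finset.mem_insert_of_mem))
          (And.imp_left (Finset.mem_insert_of_mem))
      · rcases Nat.eq_or_lt_of_le hkN with rfl | hkN
        · left
          rw [hpos₃ _ (by omega), hpos₃ _ le_rfl, hpos₂ _ le_rfl, hp₂]
          exact ⟨hp, Finset.mem_insert_self y Y⟩
        · obtain rfl : k = N + 1 := by omega
          right
          rw [hpos₃ _ le_rfl, hp₂]
          exact ⟨Finset.mem_insert_self y Y, hp₃⟩
    · rw [Finset.range_add_one, Finset.filter_insert, if_pos hp₃, Finset.card_insert_of_notMem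
        (by simp), Finset.range_add_one, Finset.filter_insert, if_neg, ← hcard]
      · congr 2
        refine Finset.filter_congr fun k hk => ?_
        rw [Finset.mem_range] at hk
        rw [hpos₃ k (by omega), hpos₂ k (by omega)]
      · rw [hpos₃ _ le_rfl, hp₂]
        exact hxy.ne'

/-- Excursions exhaust all ports at `x` but one; two different returns through `z` then compete for
the last one, and `deg z ≤ deg x` turns this into a repetition at `z`. -/
lemma trapped_of_degree_le {D : ℕ} (hD : ∀ v, G.degree v ≤ D) {s : State G} {L : Labeling G}
    {n : ℕ} (hL : NoRepeat L s (n + 1)) {x z z' : V} (hx : pos L s (n + 1) = x)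
    (hfirst : ∀ k ≤ n, pos L s k ≠ x) (hxz : G.Adj x z) (hz : ∀ k ≤ n + 1, pos L s k ≠ z)
    (hzz' : G.Adj z z') (hz'x : z' ≠ x) (hdeg : G.degree z ≤ G.degree x) :
    Trapped D s L (n + 1) (2 * D) := by
  classical
  have hux : G.Adj x (pos L s n) := hx ▸ (adj_pos L s n).symm
  have huz : pos L s n ≠ z := hz n n.le_succ
  -- The vertex `pos L s n` is left out because its arc to `x` is already used, and `z` is kept for
  -- the final routes.
  set Y := ((G.neighborFinset x).erase z).erase (pos L s n)
  have hYcard : Y.card + 2 = G.degree x := by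
    have h₁ : z ∈ G.neighborFinset x := by simpa using hxz
    have h₂ : pos L s n ∈ (G.neighborFinset x).erase z := by
      simp [huz, hux]
    have h₃ := Finset.card_erase_add_one h₁
    have h₄ : Y.card + 1 = _ := Finset.card_erase_add_one h₂
    rw [G.card_neighborFinset_eq_degree] at h₃
    omega
  have hzY : z ∉ Y := by simp [Y]
  have hdx := hD x
  rcases trapped_or_excursions hD hL hx hfirst Y (by simp +contextual [Y]) with
    h | ⟨L₁, hE, hR, hp, harc, hcard⟩
  · exact Trapped.of_extends (Extends.refl D s L _) h (by omega)
  set N := n + 1 + 2 * Y.card with hN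
  have hz₁ : ∀ k ≤ N, pos L₁ s k ≠ z := by
    intro k hk h
    rcases Nat.lt_or_ge n k with hnk | hnk
    · rcases Nat.eq_or_lt_of_le hk with rfl | hk
      · exact hxz.ne (hp.symm.trans h)
      · rcases harc k hnk hk with ⟨h', _⟩ | ⟨h', _⟩
        · exact hxz.ne (h'.symm.trans h)
        · exact hzY (h ▸ h')
    · exact hz k (by omega) (by rw [← hE.pos_eq (by omega)]; exact h)
  -- Otherwise every forced continuation by at most four further steps is free of repetitions.
  by_contra hT
  have hno : ∀ L' n', Extends D s L₁ N L' n' → n' ≤ N + 4 → NoRepeat L' s n' := fun L' n' h hn => by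
    by_contra hR'
    exact hT ⟨L', n', hE.trans h, by omega, hR'⟩
  -- the step from `x` to `z`
  obtain ⟨L₂, hE₂, hp₂⟩ := exists_extends_succ hD hR (hp.symm ▸ hxz)
    (fun k hk _ => hz₁ (k + 1) hk)
  have hR₂ := hno L₂ _ hE₂ (by omega)
  have hpN₂ : pos L₂ s N = x := (hE₂.pos_eq le_rfl).trans hp
  have hz₂ : ∀ k ≤ N, pos L₂ s k ≠ z := fun k hk => by
    rw [hE₂.pos_eq hk]
    exact hz₁ k hk
  -- the route through `z` back to `x`
  obtain ⟨L₃, hE₃, hp₃⟩ := exists_extends_succ hD hR₂ (hp₂.symm ▸ hxz.symm)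
    (fun k hk h => absurd (h.trans hp₂) (hz₂ k (by omega)))
  have hR₃ := hno L₃ _ (hE₂.trans hE₃) (by omega)
  -- the route through `z`, `z'` and `z` back to `x`
  obtain ⟨L₄, hE₄, hp₄⟩ := exists_extends_succ hD hR₂ (hp₂.symm ▸ hzz')
    (fun k hk h => absurd (h.trans hp₂) (hz₂ k (by omega)))
  have hR₄ := hno L₄ _ (hE₂.trans hE₄) (by omega)
  have hp₄' : pos L₄ s (N + 1) = z := (hE₄.pos_eq le_rfl).trans hp₂
  have hpN₄ : pos L₄ s N = x := (hE₄.pos_eq N.le_succ).trans hpN₂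
  have hz₄ : ∀ k ≤ N, pos L₄ s k ≠ z := fun k hk => by
    rw [hE₄.pos_eq (by omega)]
    exact hz₂ k hk
  -- The vertex `z'` may be an old one; its arc to `z` is still unused since `z` was entered only
  -- once, from `x`.
  obtain ⟨L₅, hE₅, hp₅⟩ := exists_extends_succ hD hR₄ (w := z) (hp₄.symm ▸ hzz'.symm) (by
    intro k hk h₁ h₂
    rcases Nat.lt_or_ge k N with h | h
    · exact hz₄ (k + 1) h h₂
    · rcases Nat.eq_or_lt_of_le h with rfl | h
      · exact hz'x (hp₄.symm.trans (h₁.symm.trans hpN₄))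
      · obtain rfl : k = N + 1 := by omega
        exact hzz'.ne (hp₄'.symm.trans (h₁.trans hp₄)))
  have hR₅ := hno L₅ _ ((hE₂.trans hE₄).trans hE₅) (by omega)
  obtain ⟨L₆, hE₆, hp₆⟩ := exists_extends_succ hD hR₅ (w := x) (hp₅.symm ▸ hxz.symm) (by
    intro k hk h₁ h₂
    rw [hp₅] at h₁
    rw [hE₅.pos_eq (by omega)] at h₁
    rcases Nat.lt_or_ge N k with h | h
    · rcases Nat.eq_or_lt_of_le (show N + 1 ≤ k from h) with rfl | h
      · rw [hE₅.pos_eq le_rfl] at h₂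
        exact hz'x (hp₄.symm.trans h₂)
      · obtain rfl : k = N + 1 + 1 := by omega
        exact hzz'.ne (h₁.symm.trans hp₄)
    · exact hz₄ k h h₁)
  have hR₆ := hno L₆ _ (((hE₂.trans hE₄).trans hE₅).trans hE₆) (by omega)
  -- the ports
  set K := (Finset.range (N + 1)).filter fun k => pos L₁ s k = x with hK
  set P := K.image (port L₁ s) with hP
  have hPcard : P.card = Y.card + 1 := by
    rw [hP, Finset.card_image_of_injOn, hcard]
    intro i hi j hj hij
    simp only [hK, Finset.coe_filter, Finset.mem_range, Set.mem_ofPred_eq] at hi hj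
    rcases lt_trichotomy i j with h | h | h
    · exact absurd hij (hR.port_ne h (by omega) (hi.2.trans hj.2.symm))
    · exact h
    · exact absurd hij.symm (hR.port_ne h (by omega) (hj.2.trans hi.2.symm))
  have hnew : ∀ (L' : Labeling G) n', Extends D s L₁ N L' n' → N < n' → NoRepeat L' s n' →
      pos L' s n' = x → port L' s n' ∈ Finset.range (G.degree x) \ P := by
    intro L' n' h hn hR' hp'
    rw [Finset.mem_sdiff, Finset.mem_range]
    refine ⟨hp' ▸ port_lt L' s n', fun hmem => ?_⟩
    obtain ⟨k, hk, hkp⟩ := Finset.mem_image.1 hmem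
    simp only [hK, Finset.mem_filter, Finset.mem_range] at hk
    refine hR'.port_ne (i := k) (by omega) le_rfl ?_ ?_
    · rw [h.pos_eq (by omega), hk.2, hp']
    · rw [h.port_eq (by omega), hkp]
  have hPsub : P ⊆ Finset.range (G.degree x) := by
    intro i hi
    obtain ⟨k, hk, rfl⟩ := Finset.mem_image.1 hi
    simp only [hK, Finset.mem_filter, Finset.mem_range] at hk
    rw [Finset.mem_range, ← hk.2]
    exact port_lt L₁ s k
  -- The `deg x - 1` visits to `x` up to time `N` have distinct ports, which leaves one.
  have hone : (Finset.range (G.degree x) \ P).card ≤ 1 := by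
    rw [Finset.card_sdiff_of_subset hPsub, Finset.card_range, hPcard]
    omega
  have heq : port L₃ s (N + 1 + 1) = port L₆ s (N + 1 + 1 + 1 + 1) :=
    Finset.card_le_one.1 hone _ (hnew _ _ (hE₂.trans hE₃) (by omega) hR₃ hp₃) _
      (hnew _ _ (((hE₂.trans hE₄).trans hE₅).trans hE₆) (by omega) hR₆ hp₆)
  -- The port on return is the successor modulo `deg x` of the port at `z`; both ports at `z` are
  -- below `deg z ≤ deg x`, so their residues determine them.
  rw [port_succ, port_succ L₆, hp₃, hp₆, hE₃.port_eq le_rfl, hE₆.port_eq le_rfl] at heq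
  have hlt₁ : port L₂ s (N + 1) < G.degree x := (hp₂ ▸ port_lt L₂ s (N + 1)).trans_le hdeg
  have hlt₂ : port L₅ s (N + 1 + 1 + 1) < G.degree x :=
    (hp₅ ▸ port_lt L₅ s (N + 1 + 1 + 1)).trans_le hdeg
  have hports : port L₂ s (N + 1) = port L₅ s (N + 1 + 1 + 1) := by
    have h : port L₂ s (N + 1) ≡ port L₅ s (N + 1 + 1 + 1) [MOD G.degree x] :=
      Nat.ModEq.add_right_cancel' 1 heq
    exact Nat.ModEq.eq_of_lt_of_lt h hlt₁ hlt₂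
  refine hR₅.port_ne (i := N + 1) (j := N + 1 + 1 + 1) (by omega) le_rfl ?_ ?_
  · rw [hE₅.pos_eq (by omega), hp₄', hp₅]
  · rw [hE₅.port_eq (by omega), hE₄.port_eq le_rfl, hports]

/-- From a vertex visited for the first time at which a long path of unvisited vertices starts, the
walk repeats a state soon with conditional probability bounded below. -/
lemma trapped_of_isPath {D : ℕ} (hD : ∀ v, G.degree v ≤ D) {s : State G} (m : ℕ)
    {L : Labeling G} {n : ℕ} (hL : NoRepeat L s (n + 1))
    (hfirst : ∀ k ≤ n, pos L s k ≠ pos L s (n + 1)) {t : V} (p : G.Walk (pos L s (n + 1)) t)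
    (hp : p.IsPath) (hlen : m + 2 ≤ p.length) (hm : D ≤ G.degree (pos L s (n + 1)) + m)
    (hfresh : ∀ y ∈ p.support.tail, ∀ k ≤ n + 1, pos L s k ≠ y) :
    Trapped D s L (n + 1) (m + 2 * D) := by
  induction m generalizing L n with
  | zero =>
    -- Here `deg x ≥ D`, so the next vertex of the path cannot have larger degree.
    generalize hx : pos L s (n + 1) = x at *
    match p, hp, hlen, hfresh with
    | .cons h (.cons h' q), hp, hlen, hfresh =>
      rw [Nat.zero_add]
      refine trapped_of_degree_le hD hL hx hfirst h (hfresh _ (by simp)) h' ?_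
        ((hD _).trans (by omega))
      rintro rfl
      simp at hp
  | succ m ih =>
    generalize hx : pos L s (n + 1) = x at *
    match p, hp, hlen, hfresh with
    | .cons (v := z) h (.cons h' q), hp, hlen, hfresh =>
      by_cases hdeg : G.degree z ≤ G.degree x
      · refine Trapped.of_extends (Extends.refl D s L _) (trapped_of_degree_le hD hL hx hfirst h
          (hfresh _ (by simp)) h' ?_ hdeg) (by omega)
        rintro rfl
        simp at hp
      -- Moving on to `z` raises the degree by at least one and spends one edge of the path, which
      -- pays for lowering `m`.
      · have hzf : ∀ k ≤ n + 1, pos L s k ≠ z := hfresh z (by simp)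
        obtain ⟨L₁, hE, hp₁⟩ := exists_extends_succ hD hL (hx.symm ▸ h)
          (fun k hk _ => hzf (k + 1) hk)
        by_cases hR : NoRepeat L₁ s (n + 1 + 1)
        swap
        · exact ⟨L₁, _, hE, by omega, hR⟩
        subst hp₁
        refine Trapped.of_extends hE (ih hR (fun k hk => ?_) (.cons h' q) hp.of_cons ?_ ?_ ?_)
          (by omega)
        · rw [hE.pos_eq hk]
          exact hzf k hk
        · simpa using hlen
        · omega
        · intro y hy k hk
          rcases Nat.eq_or_lt_of_le hk with rfl | hk
          · rintro rfl
            have := hp.of_cons.support_nodup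
            rw [← SimpleGraph.Walk.cons_tail_support] at this
            exact (List.nodup_cons.1 this).1 hy
          · rw [hE.pos_eq (by omega)]
            exact hfresh y (by
              rw [SimpleGraph.Walk.support_cons, List.tail_cons]
              exact List.mem_of_mem_tail hy) k (by omega)

end BasicWalk

/-! ### Promising times occur arbitrarily late -/

namespace BasicWalk

variable {V : Type*} {G : SimpleGraph V} [G.LocallyFinite]

lemma finite_setOf_walk_length_le (r : ℕ) {A : Set V} (hA : A.Finite) :
    {t | ∃ a ∈ A, ∃ p : G.Walk a t, p.length ≤ r}.Finite := by
  induction r generalizing A with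
  | zero =>
    refine hA.subset ?_
    rintro t ⟨a, ha, p, hp⟩
    rwa [← SimpleGraph.Walk.eq_of_length_eq_zero (Nat.le_zero.1 hp)]
  | succ r ih =>
    refine (hA.union (ih (hA.biUnion fun a _ => (G.neighborSet a).toFinite))).subset ?_
    rintro t ⟨a, ha, p, hp⟩
    cases p with
    | nil => exact Or.inl ha
    | cons h q =>
      refine Or.inr ⟨_, Set.mem_biUnion ha h, q, ?_⟩
      simpa using hp

lemma exists_pos_notMem {L : Labeling G} {s : State G} (h : Function.Injective (walk L s))
    {F : Set V} (hF : F.Finite) : ∃ m, pos L s m ∉ F := by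
  by_contra! hc
  have hfin : (⋃ v ∈ F, Set.range fun i : Fin (G.degree v) => (⟨v, i⟩ : State G)).Finite :=
    hF.biUnion fun v _ => Set.finite_range _
  refine Set.infinite_range_of_injective h (hfin.subset ?_)
  rintro _ ⟨m, rfl⟩
  exact Set.mem_biUnion (hc m) ⟨(walk L s m).2, rfl⟩

/-- At time `n + 1` the walk is at a new vertex at which a path of unvisited vertices of length at
least `ℓ` starts. -/
def Promising (ℓ : ℕ) (s : State G) (L : Labeling G) (n : ℕ) : Prop :=
  (∀ k ≤ n, pos L s k ≠ pos L s (n + 1)) ∧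
    ∃ (t : V) (p : G.Walk (pos L s (n + 1)) t), p.IsPath ∧ ℓ ≤ p.length ∧
      ∀ y ∈ p.support.tail, ∀ k ≤ n + 1, pos L s k ≠ y

lemma Promising.of_mem_cylinder {ℓ : ℕ} {s : State G} {L L' : Labeling G} {n m : ℕ}
    (h : Promising ℓ s L n) (hL : L' ∈ cylinder L s m) (hm : n + 1 ≤ m) :
    Promising ℓ s L' n := by
  obtain ⟨h₁, t, p, hp, hl, h₂⟩ := h
  have hpos : ∀ k ≤ n + 1, pos L' s k = pos L s k := fun k hk =>
    pos_eq_of_mem_cylinder hL (hk.trans hm)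
  refine ⟨fun k hk => ?_, t, p.copy (hpos _ le_rfl).symm rfl, ?_, ?_, fun y hy k hk => ?_⟩
  · rw [hpos k (by omega), hpos _ le_rfl]
    exact h₁ k hk
  · simpa using hp
  · simpa using hl
  · rw [SimpleGraph.Walk.support_copy] at hy
    rw [hpos k hk]
    exact h₂ y hy k hk

/-- The walk must leave every ball around the finite set `A` of vertices visited by time `N`. The
first entry into the component of a far vertex outside `A` happens directly from `A`, and a path
from there to the far vertex stays in this still unvisited component. -/
lemma exists_promising {L : Labeling G} {s : State G} (h : Function.Injective (walk L s))
    (ℓ N : ℕ) : ∃ n, N ≤ n ∧ Promising ℓ s L n := by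
  classical
  set A : Set V := pos L s '' Set.Iic N
  have hA : A.Finite := (Set.finite_Iic N).image _
  obtain ⟨m, hm⟩ := exists_pos_notMem h (finite_setOf_walk_length_le (G := G) ℓ hA)
  have hmA : pos L s m ∉ A := fun hmem => hm ⟨_, hmem, .nil, by simp⟩
  let C : Set V := {y | ∃ q : G.Walk y (pos L s m), ∀ u ∈ q.support, u ∉ A}
  have hCA : ∀ y ∈ C, y ∉ A := fun y ⟨q, hq⟩ => hq y q.start_mem_support
  have hex : ∃ n, pos L s n ∈ C := ⟨m, .nil, by simpa using hmA⟩
  obtain ⟨q, hq⟩ := Nat.find_spec hex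
  have hmin : ∀ k < Nat.find hex, pos L s k ∉ C := fun k hk => Nat.find_min hex hk
  have hnA := hCA _ (Nat.find_spec hex)
  generalize Nat.find hex = n' at *
  have hNn : N < n' := by
    by_contra hle
    exact hnA ⟨n', not_lt.1 hle, rfl⟩
  obtain ⟨n, rfl⟩ : ∃ n, n' = n + 1 := ⟨n' - 1, by omega⟩
  have hprev : pos L s n ∈ A := by
    by_contra hnot
    refine hmin n n.lt_succ_self ⟨.cons (adj_pos L s n) q, ?_⟩
    simpa [hnot] using hq
  have hpA : ∀ u ∈ q.bypass.support, u ∉ A := fun u hu => hq u (q.support_bypass_subset_support hu)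
  have hpC : ∀ u ∈ q.bypass.support, u ∈ C := fun u hu =>
    ⟨q.bypass.dropUntil u hu, fun w hw =>
      hpA w (q.bypass.support_dropUntil_subset_support hu hw)⟩
  refine ⟨n, by omega, fun k hk hkn => hmin k (by omega) ?_, _, q.bypass, q.bypass_isPath, ?_,
    fun y hy k hk hky => ?_⟩
  · rw [hkn]
    exact ⟨q, hq⟩
  -- A shorter path, preceded by the edge from `A`, would put the far vertex within distance `ℓ` of
  -- `A`.
  · by_contra hlt
    exact hm ⟨_, hprev, .cons (adj_pos L s n) q.bypass, by
      rw [SimpleGraph.Walk.length_cons]; omega⟩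
  · rcases Nat.eq_or_lt_of_le hk with rfl | hk
    · have hnd := q.bypass_isPath.support_nodup
      rw [← SimpleGraph.Walk.cons_tail_support] at hnd
      exact (List.nodup_cons.1 hnd).1 (hky ▸ hy)
    · exact hmin k hk (hky ▸ hpC y (List.mem_of_mem_tail hy))

lemma cycles_of_walk_eq {L : Labeling G} {s : State G} {i j : ℕ} (hij : i < j)
    (h : walk L s i = walk L s j) : Cycles L s := by
  refine ⟨i, j - i, by omega, fun n hn => ?_⟩
  obtain ⟨k, rfl⟩ := Nat.exists_eq_add_of_le hn
  have hadd : ∀ a, walk L s (k + a) = (step L)^[k] (walk L s a) := fun a =>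
    Function.iterate_add_apply _ _ _ _
  rw [show i + k + (j - i) = k + j by omega, Nat.add_comm i k, hadd, hadd, h]

lemma noRepeat_of_not_cycles {L : Labeling G} {s : State G} (h : ¬ Cycles L s) (n : ℕ) :
    NoRepeat L s n := fun _ _ hij _ he => h (cycles_of_walk_eq hij he)

lemma injective_of_noRepeat {L : Labeling G} {s : State G} (h : ∀ n, NoRepeat L s n) :
    Function.Injective (walk L s) := by
  intro i j hij
  by_contra hne
  rcases lt_or_gt_of_ne hne with hlt | hlt
  · exact h j i j hlt le_rfl hij
  · exact h i j i hlt le_rfl hij.symm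

/-! ### The probability estimate -/

/-- The time `n` is the first promising time after `N` and no state has been repeated. -/
def FirstPromising (ℓ N : ℕ) (s : State G) (L : Labeling G) (n : ℕ) : Prop :=
  N ≤ n ∧ NoRepeat L s (n + 1) ∧ Promising ℓ s L n ∧ ∀ k, N ≤ k → k < n → ¬ Promising ℓ s L k

lemma FirstPromising.of_mem_cylinder {ℓ N : ℕ} {s : State G} {L L' : Labeling G} {n : ℕ}
    (h : FirstPromising ℓ N s L n) (hL : L' ∈ cylinder L s (n + 1)) :
    FirstPromising ℓ N s L' n := by
  refine ⟨h.1, h.2.1.of_mem_cylinder hL, h.2.2.1.of_mem_cylinder hL le_rfl,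
    fun k hk hkn hP => h.2.2.2 k hk hkn (hP.of_mem_cylinder (m := n + 1) ?_ (by omega))⟩
  exact fun k hk => (hL k hk).symm

lemma FirstPromising.unique {ℓ N : ℕ} {s : State G} {L : Labeling G} {n n' : ℕ}
    (h : FirstPromising ℓ N s L n) (h' : FirstPromising ℓ N s L n') : n = n' := by
  rcases lt_trichotomy n n' with hlt | heq | hlt
  · exact absurd h.2.2.1 (h'.2.2.2 n h.1 hlt)
  · exact heq
  · exact absurd h'.2.2.1 (h.2.2.2 n' h'.1 hlt)

instance : IsProbabilityMeasure (labelingLaw G) := by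
  unfold labelingLaw
  infer_instance

variable [Countable V]

lemma measurableSet_forall_noRepeat (s : State G) :
    MeasurableSet {L : Labeling G | ∀ n, NoRepeat L s n} := by
  simp_rw [Set.ofPred_forall]
  exact MeasurableSet.iInter fun n => measurableSet_noRepeat s n

/-- The trapped continuation occupies at least a fraction `D ^ (-3D)` of the cylinder and is
disjoint from the event of no repetition. The additive form avoids subtraction in `ENNReal`. -/
lemma measure_cylinder_inter_le {D : ℕ} (hD : ∀ v, G.degree v ≤ D) (hD₀ : 1 ≤ D) {N : ℕ}
    {s : State G} {L : Labeling G} {n : ℕ} (h : FirstPromising (D + 2) N s L n) :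
    (D : ENNReal) ^ (3 * D) *
        labelingLaw G (cylinder L s (n + 1) ∩ {L | ∀ n, NoRepeat L s n}) +
      labelingLaw G (cylinder L s (n + 1)) ≤
    (D : ENNReal) ^ (3 * D) * labelingLaw G (cylinder L s (n + 1)) := by
  obtain ⟨-, hR, ⟨hfirst, t, p, hp, hlen, hfresh⟩, -⟩ := h
  -- The choice `m = D` needs no lower bound on the degree; it gives the path length `D + 2` and at
  -- most `D + 2 * D` steps.
  obtain ⟨L', n', hE, hn', hR'⟩ := trapped_of_isPath hD D hR hfirst p hp hlen (by omega) hfresh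
  have hsub : cylinder L' s n' ⊆ cylinder L s (n + 1) := fun L'' hL'' k hk => by
    rw [hL'' k (hk.trans hE.le), hE.mem k hk]
  have hdisj : Disjoint (cylinder L s (n + 1) ∩ {L | ∀ n, NoRepeat L s n}) (cylinder L' s n') := by
    rw [Set.disjoint_left]
    rintro L'' ⟨-, hall⟩ hL''
    exact hR' ((hall n').of_mem_cylinder fun k hk => (hL'' k hk).symm)
  have hD' : (1 : ENNReal) ≤ D := by exact_mod_cast hD₀
  calc _ ≤ (D : ENNReal) ^ (3 * D) *
        labelingLaw G (cylinder L s (n + 1) ∩ {L | ∀ n, NoRepeat L s n}) +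
        (D : ENNReal) ^ (3 * D) * labelingLaw G (cylinder L' s n') := by
        gcongr
        refine hE.measure_le.trans ?_
        gcongr
        omega
    _ = (D : ENNReal) ^ (3 * D) * labelingLaw G
        ((cylinder L s (n + 1) ∩ {L | ∀ n, NoRepeat L s n}) ∪ cylinder L' s n') := by
        rw [measure_union hdisj (measurableSet_cylinder L' s n'), mul_add]
    _ ≤ _ := by
        gcongr
        exact Set.union_subset Set.inter_subset_left hsub

lemma measure_forall_noRepeat_le {D : ℕ} (hD : ∀ v, G.degree v ≤ D) (hD₀ : 1 ≤ D) (s : State G)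
    (N : ℕ) :
    (D : ENNReal) ^ (3 * D) * labelingLaw G {L | ∀ n, NoRepeat L s n} +
      labelingLaw G {L | ∀ n, NoRepeat L s n} ≤
    (D : ENNReal) ^ (3 * D) * labelingLaw G {L | NoRepeat L s N} := by
  set E : Set (Labeling G) := {L | ∀ n, NoRepeat L s n}
  set c : ENNReal := (D : ENNReal) ^ (3 * D)
  -- Countably many disjoint pieces, indexed by the first promising time and the history up to it;
  -- each nonempty one is a cylinder, so the cylinder estimate can be summed.
  let B : (Σ n : ℕ, Fin (n + 2) → State G) → Set (Labeling G) := fun i =>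
    {L | FirstPromising (D + 2) N s L i.1 ∧ ∀ k : Fin (i.1 + 2), walk L s k = i.2 k}
  have hB : ∀ i, ∀ L ∈ B i, B i = cylinder L s (i.1 + 1) := by
    rintro ⟨n, f⟩ L ⟨hL, hf⟩
    ext L'
    constructor
    · rintro ⟨-, hf'⟩ k hk
      exact (hf' ⟨k, by simp at hk ⊢; omega⟩).trans (hf ⟨k, by simp at hk ⊢; omega⟩).symm
    · intro hL'
      exact ⟨hL.of_mem_cylinder hL', fun k => (hL' k (by
        have := k.isLt; simp at this ⊢; omega)).trans (hf k)⟩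
  have hmeas : ∀ i, MeasurableSet (B i) := by
    intro i
    rcases (B i).eq_empty_or_nonempty with h | ⟨L, hL⟩
    · rw [h]; exact MeasurableSet.empty
    · rw [hB i L hL]; exact measurableSet_cylinder L s _
  have hdisj : Pairwise (Function.onFun Disjoint B) := by
    rintro ⟨n, f⟩ ⟨n', f'⟩ hne
    rw [Function.onFun, Set.disjoint_left]
    rintro L ⟨h, hf⟩ ⟨h', hf'⟩
    obtain rfl : n = n' := h.unique h'
    exact hne (congrArg _ (funext fun k => (hf k).symm.trans (hf' k)))
  have hle : ∀ i, c * labelingLaw G (B i ∩ E) + labelingLaw G (B i) ≤ c * labelingLaw G (B i) := by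
    intro i
    rcases (B i).eq_empty_or_nonempty with h | ⟨L, hL⟩
    · simp [h]
    · rw [hB i L hL]; exact measure_cylinder_inter_le hD hD₀ hL.1
  have hcover : E ⊆ ⋃ i, B i := by
    intro L hL
    classical
    have hex := exists_promising (injective_of_noRepeat hL) (D + 2) N
    exact Set.mem_iUnion.2 ⟨⟨Nat.find hex, fun k => walk L s k⟩,
      ⟨(Nat.find_spec hex).1, hL _, (Nat.find_spec hex).2,
        fun k hk hkn hP => Nat.find_min hex hkn ⟨hk, hP⟩⟩, fun _ => rfl⟩
  have hsub : ⋃ i, B i ⊆ {L | NoRepeat L s N} := by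
    refine Set.iUnion_subset fun i L hL => hL.1.2.1.mono ?_
    have := hL.1.1
    omega
  have hEsum : labelingLaw G E = ∑' i, labelingLaw G (B i ∩ E) := by
    rw [← measure_iUnion (fun i j hij => (hdisj hij).mono Set.inter_subset_left
      Set.inter_subset_left) fun i => (hmeas i).inter (measurableSet_forall_noRepeat s),
      ← Set.iUnion_inter, Set.inter_eq_self_of_subset_right hcover]
  calc c * labelingLaw G E + labelingLaw G E
      ≤ c * labelingLaw G E + labelingLaw G (⋃ i, B i) := by gcongr
    _ = ∑' i, (c * labelingLaw G (B i ∩ E) + labelingLaw G (B i)) := by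
        rw [ENNReal.tsum_add, ENNReal.tsum_mul_left, ← hEsum, measure_iUnion hdisj hmeas]
    _ ≤ ∑' i, c * labelingLaw G (B i) := ENNReal.tsum_le_tsum hle
    _ = c * labelingLaw G (⋃ i, B i) := by
        rw [ENNReal.tsum_mul_left, measure_iUnion hdisj hmeas]
    _ ≤ c * labelingLaw G {L | NoRepeat L s N} := by gcongr

lemma measure_forall_noRepeat {D : ℕ} (hD : ∀ v, G.degree v ≤ D) (s : State G) :
    labelingLaw G {L | ∀ n, NoRepeat L s n} = 0 := by
  -- The initial state carries a port, so its vertex has positive degree.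
  have hD₀ : 1 ≤ D := (Nat.succ_le_of_lt (Nat.zero_lt_of_lt s.2.isLt)).trans (hD s.1)
  have hlim : Filter.Tendsto (fun N => labelingLaw G {L | NoRepeat L s N}) Filter.atTop
      (nhds (labelingLaw G {L | ∀ n, NoRepeat L s n})) := by
    rw [Set.ofPred_forall]
    exact tendsto_measure_iInter_atTop (fun N => (measurableSet_noRepeat s N).nullMeasurableSet)
      (fun m n hmn L hL => hL.mono hmn) ⟨0, measure_ne_top _ _⟩
  have hc : (D : ENNReal) ^ (3 * D) ≠ ⊤ := ENNReal.pow_ne_top (ENNReal.natCast_ne_top D)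
  have hle := ge_of_tendsto' (ENNReal.Tendsto.const_mul hlim (Or.inr hc))
    (measure_forall_noRepeat_le hD hD₀ s)
  have hfin := ENNReal.mul_ne_top hc (measure_ne_top (labelingLaw G) {L | ∀ n, NoRepeat L s n})
  exact nonpos_iff_eq_zero.1
    ((ENNReal.add_le_add_iff_left hfin).1 (hle.trans_eq (add_zero _).symm))

end BasicWalk

theorem mainTheorem1 {V : Type*} [Countable V] (G : SimpleGraph V) [G.LocallyFinite]
    (hconn : G.Connected) (D : ℕ) (hD : ∀ v, G.degree v ≤ D) (s : BasicWalk.State G) :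
    ∀ᵐ L ∂(BasicWalk.labelingLaw G), BasicWalk.Cycles L s := by
  rw [ae_iff]
  exact measure_mono_null (fun L hL n => BasicWalk.noRepeat_of_not_cycles hL n)
    (BasicWalk.measure_forall_noRepeat hD s)
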